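/- Let $\mathcal{A}$ be a complex unital Banach algebra with identity $1$, and for $x\in\mathcal{A}$ let $\sigma(x)=\{\lambda\in\mathbb{C}: x-\lambda 1 \text{ is not invertible in } \mathcal{A}\}$ be its spectrum. A sequence $(a_n)$ in $\mathcal{A}$ is said to be $\nu$-convergent to $a\in\mathcal{A}$ if the sequence $(\|a_n\|)$ is bounded, $\|(a_n-a)a\|\to 0$ and $\|(a_n-a)a_n\|\to 0$. Let $a\in\mathcal{A}$ and let $(a_n)$ be a sequence in $\mathcal{A}$ that is $\nu$-convergent to $a$. If $U\subseteq\mathbb{C}$ is an open set such that $0\notin U$ and $U$ contains a connected component of $\sigma(a)$, then there exists $n_0\in\mathbb{N}$ such that, for all $n\geq n_0$, $U$ contains a connected component of $\sigma(a_n)$. -/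

import Mathlib

open Filter Topology

/-- `ν`-convergence of a sequence `u` to `x` in a normed ring: the norms `‖u n‖` are bounded,
`‖(u n - x) * x‖ → 0` and `‖(u n - x) * u n‖ → 0`. -/
def NuConverges {A : Type*} [NormedRing A] (u : ℕ → A) (x : A) : Prop :=
  (∃ M : ℝ, ∀ n, ‖u n‖ ≤ M) ∧
    Tendsto (fun n => ‖(u n - x) * x‖) atTop (𝓝 0) ∧
    Tendsto (fun n => ‖(u n - x) * u n‖) atTop (𝓝 0)

/-- `K` is a connected component of the subspace `S`, i.e. the component in `S` of one of the
points of `S`. In particular `K` is non-empty. -/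
def IsComponentOf {X : Type*} [TopologicalSpace X] (K S : Set X) : Prop :=
  ∃ x ∈ S, K = connectedComponentIn S x

/-! Write `d = b - a` with `b = u n`. Although `d` need not be small, `d * d` is, so `z - d` is
invertible with uniformly bounded inverse for `z` in a compact set avoiding 0. The identity `z (z -
b) = (z - d) (z - a) - d a` then passes resolvent bounds between `a` and `b`. Enclose part of the
spectrum of `a` in an open `V` with compact closure in `U` and frontier off the spectrum. For large
`n` the resolvent of `b` is bounded on the frontier, uniformly in `n`. Were the spectrum of `b` to
miss `V`, the maximum principle would extend this bound to `V`, and the identity read backwards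
would clear `V` of spectrum of `a`. So the spectrum of `b` meets `V` but not its frontier, and a
component lies in `V`. -/

section InversePerturbation

variable {A : Type*} [NormedRing A] [CompleteSpace A]

/-- Quantitative openness of the group of units. -/
theorem isUnit_sub_and_norm_inverse_le {t e : A} {B : ℝ} (ht : IsUnit t)
    (hB : ‖Ring.inverse t‖ ≤ B) (he : ‖e‖ * B ≤ 1 / 2) :
    IsUnit (t - e) ∧ ‖Ring.inverse (t - e)‖ ≤ 2 * B := by
  have hsmall : ‖Ring.inverse t * e‖ ≤ 1 / 2 :=
    calc ‖Ring.inverse t * e‖ ≤ ‖Ring.inverse t‖ * ‖e‖ := norm_mul_le _ _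
      _ ≤ B * ‖e‖ := by gcongr
      _ ≤ 1 / 2 := by linarith
  have hfac : t - e = t * (1 - Ring.inverse t * e) := by
    rw [mul_sub, ← mul_assoc, Ring.mul_inverse_cancel t ht, mul_one, one_mul]
  have hunit : IsUnit (t - e) := by
    rw [hfac]
    exact ht.mul (isUnit_one_sub_of_norm_lt_one (by linarith))
  refine ⟨hunit, ?_⟩
  set s := Ring.inverse (t - e)
  -- Bounding `s` through this fixed-point equation and absorbing `‖s‖ / 2` avoids the Neumann
  -- series, whose bound would involve `‖1‖`, not assumed to be 1.
  have hs : s = Ring.inverse t + Ring.inverse t * e * s := by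
    have h : (t - e) * s = 1 := Ring.mul_inverse_cancel _ hunit
    have h' : Ring.inverse t * ((t - e) * s) = s - Ring.inverse t * e * s := by
      rw [sub_mul, mul_sub, ← mul_assoc, ← mul_assoc, Ring.inverse_mul_cancel t ht,
        one_mul]
    rw [h, mul_one] at h'
    exact sub_eq_iff_eq_add.1 h'.symm
  have hnorm : ‖s‖ ≤ B + 1 / 2 * ‖s‖ :=
    calc ‖s‖ = ‖Ring.inverse t + Ring.inverse t * e * s‖ := congrArg _ hs
      _ ≤ ‖Ring.inverse t‖ + ‖Ring.inverse t * e * s‖ := norm_add_le _ _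
      _ ≤ ‖Ring.inverse t‖ + ‖Ring.inverse t * e‖ * ‖s‖ := by gcongr; exact norm_mul_le _ _
      _ ≤ B + 1 / 2 * ‖s‖ := by gcongr
  linarith

end InversePerturbation

section Resolvent

variable {A : Type*} [NormedRing A] [NormedAlgebra ℂ A]

theorem isUnit_smul_and_norm_inverse_le {z : ℂ} (hz : z ≠ 0) {t : A} (ht : IsUnit t) {B : ℝ}
    (hB : ‖Ring.inverse t‖ ≤ B) :
    IsUnit (z • t) ∧ ‖Ring.inverse (z • t)‖ ≤ ‖z‖⁻¹ * B := by
  have h₁ : (z • t) * (z⁻¹ • Ring.inverse t) = 1 := by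
    rw [smul_mul_smul_comm, mul_inv_cancel₀ hz, Ring.mul_inverse_cancel t ht, one_smul]
  have h₂ : (z⁻¹ • Ring.inverse t) * (z • t) = 1 := by
    rw [smul_mul_smul_comm, inv_mul_cancel₀ hz, Ring.inverse_mul_cancel t ht, one_smul]
  have hinv : Ring.inverse (z • t) = z⁻¹ • Ring.inverse t :=
    Ring.inverse_unit ⟨z • t, z⁻¹ • Ring.inverse t, h₁, h₂⟩
  refine ⟨⟨⟨_, _, h₁, h₂⟩, rfl⟩, ?_⟩
  rw [hinv, norm_smul, norm_inv]
  gcongr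

/-- The factorization of `z - b` up to the error `(b - a) * a`. -/
theorem smul_algebraMap_sub (z : ℂ) (a b : A) :
    z • (algebraMap ℂ A z - b) =
      (algebraMap ℂ A z - (b - a)) * (algebraMap ℂ A z - a) - (b - a) * a := by
  rw [Algebra.smul_def]
  have h := Algebra.commutes z (b - a)
  rw [sub_mul _ (b - a), mul_sub (b - a), ← h]
  noncomm_ring

variable [CompleteSpace A]

/-- If `d * d` is small, then `z - d` is invertible for `z` away from zero. -/
theorem isUnit_algebraMap_sub_of_norm_mul_self {z : ℂ} {d : A} {r L D : ℝ} (hr : 0 < r)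
    (hrz : r ≤ ‖z‖) (hzL : ‖z‖ ≤ L) (hD : ‖d‖ ≤ D)
    (hd : ‖d * d‖ * (r⁻¹ * (r⁻¹ * ‖(1 : A)‖)) ≤ 1 / 2) :
    IsUnit (algebraMap ℂ A z - d) ∧ ‖Ring.inverse (algebraMap ℂ A z - d)‖ ≤
      (L * ‖(1 : A)‖ + D) * (2 * (r⁻¹ * (r⁻¹ * ‖(1 : A)‖))) := by
  have hz : z ≠ 0 := norm_pos_iff.1 (hr.trans_le hrz)
  have hsq : IsUnit (z • z • (1 : A)) ∧
      ‖Ring.inverse (z • z • (1 : A))‖ ≤ r⁻¹ * (r⁻¹ * ‖(1 : A)‖) := by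
    have h₁ := isUnit_smul_and_norm_inverse_le hz (isUnit_one (M := A))
      (by rw [Ring.inverse_one])
    have h₂ := isUnit_smul_and_norm_inverse_le hz h₁.1 h₁.2
    refine ⟨h₂.1, h₂.2.trans ?_⟩
    gcongr
  obtain ⟨hu, hn⟩ := isUnit_sub_and_norm_inverse_le hsq.1 hsq.2 hd
  have hc := Algebra.commutes z d
  have hcomm : Commute (algebraMap ℂ A z - d) (algebraMap ℂ A z + d) := by
    rw [Commute, SemiconjBy]
    simp only [sub_mul, mul_sub, add_mul, mul_add, hc]
    abel
  -- Difference of squares: invertibility of `z² - d²` passes to its commuting factors.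
  have hprod : (algebraMap ℂ A z - d) * (algebraMap ℂ A z + d) = z • z • (1 : A) - d * d := by
    rw [← Algebra.algebraMap_eq_smul_one, Algebra.smul_def]
    simp only [sub_mul, mul_add, hc]
    abel
  have hu' := hu
  rw [← hprod, hcomm.isUnit_mul_iff] at hu'
  refine ⟨hu'.1, ?_⟩
  have hinv : Ring.inverse (algebraMap ℂ A z - d) =
      (algebraMap ℂ A z + d) * Ring.inverse (z • z • (1 : A) - d * d) := by
    have h := Ring.mul_inverse_cancel _ hu
    rw [← hprod, mul_assoc] at h
    rw [← hprod]
    calc _ = Ring.inverse (algebraMap ℂ A z - d) * 1 := (mul_one _).symm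
      _ = _ := by rw [← h, ← mul_assoc, Ring.inverse_mul_cancel _ hu'.1, one_mul]
  rw [hinv]
  refine (norm_mul_le _ _).trans ?_
  have hsum : ‖algebraMap ℂ A z + d‖ ≤ L * ‖(1 : A)‖ + D :=
    (norm_add_le _ _).trans (add_le_add
      ((norm_algebraMap A z).trans_le (by gcongr)) hD)
  have : 0 ≤ L * ‖(1 : A)‖ + D := (norm_nonneg _).trans hsum
  gcongr

/-- A bound for the resolvent of `b` at `z` in terms of that of `a`. -/
theorem mem_resolventSet_and_norm_resolvent_le {z : ℂ} {a b : A} {L B C : ℝ} (hz : z ≠ 0)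
    (hzL : ‖z‖ ≤ L) (hd : IsUnit (algebraMap ℂ A z - (b - a)))
    (hB : ‖Ring.inverse (algebraMap ℂ A z - (b - a))‖ ≤ B)
    (ha : z ∈ resolventSet ℂ a) (hC : ‖resolvent a z‖ ≤ C)
    (h : ‖(b - a) * a‖ * (C * B) ≤ 1 / 2) :
    z ∈ resolventSet ℂ b ∧ ‖resolvent b z‖ ≤ L * (2 * (C * B)) := by
  have hB0 : 0 ≤ B := (norm_nonneg _).trans hB
  have hC0 : 0 ≤ C := (norm_nonneg _).trans hC
  have hinv : ‖Ring.inverse ((algebraMap ℂ A z - (b - a)) * (algebraMap ℂ A z - a))‖ ≤ C * B := by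
    obtain ⟨v, hv⟩ := hd
    obtain ⟨w, hw⟩ := ha
    rw [resolvent, ← hw, Ring.inverse_unit] at hC
    rw [← hv, Ring.inverse_unit] at hB
    rw [← hv, ← hw, ← Units.val_mul, Ring.inverse_unit, mul_inv_rev, Units.val_mul]
    exact (norm_mul_le _ _).trans (mul_le_mul hC hB (norm_nonneg _) hC0)
  obtain ⟨hu, hn⟩ := isUnit_sub_and_norm_inverse_le (hd.mul ha) hinv h
  rw [← smul_algebraMap_sub] at hu hn
  obtain ⟨hu', hn'⟩ := isUnit_smul_and_norm_inverse_le (inv_ne_zero hz) hu hn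
  rw [inv_smul_smul₀ hz] at hu' hn'
  refine ⟨hu', hn'.trans ?_⟩
  rw [norm_inv, inv_inv]
  gcongr

/-- A bound on the resolvent of `b` at `z` forces `z` to be in the resolvent set of `a`. -/
theorem mem_resolventSet_of_norm_resolvent_le {z : ℂ} {a b : A} {r C : ℝ} (hr : 0 < r)
    (hrz : r ≤ ‖z‖) (hd : IsUnit (algebraMap ℂ A z - (b - a)))
    (hb : z ∈ resolventSet ℂ b) (hC : ‖resolvent b z‖ ≤ C)
    (h : ‖(b - a) * a‖ * (r⁻¹ * C) ≤ 1 / 2) : z ∈ resolventSet ℂ a := by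
  have hz : z ≠ 0 := norm_pos_iff.1 (hr.trans_le hrz)
  have hC0 : 0 ≤ C := (norm_nonneg _).trans hC
  obtain ⟨hu, hn⟩ := isUnit_smul_and_norm_inverse_le hz hb hC
  have hn' : ‖Ring.inverse (z • (algebraMap ℂ A z - b))‖ ≤ r⁻¹ * C := hn.trans (by gcongr)
  have h' := (isUnit_sub_and_norm_inverse_le (e := -((b - a) * a)) hu hn'
    (by rwa [norm_neg])).1
  rw [smul_algebraMap_sub z a b, sub_neg_eq_add, sub_add_cancel] at h'
  obtain ⟨v, hv⟩ := hd
  rw [← hv] at h'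
  exact (Units.isUnit_units_mul v _).1 h'

theorem differentiableOn_resolvent {a : A} {s : Set ℂ} (hs : s ⊆ resolventSet ℂ a) :
    DifferentiableOn ℂ (resolvent a) s := fun _ hz =>
  (spectrum.hasDerivAt_resolvent_const_left (hs hz)).differentiableAt.differentiableWithinAt

end Resolvent

section Components

variable {X : Type*} [TopologicalSpace X]

/-- A component of a compact set inside an open set can be separated from the rest of the
compact set. -/
theorem exists_isOpen_frontier_disjoint_of_component [T2Space X] [LocallyCompactSpace X]
    {S K U : Set X} (hS : IsCompact S) (hU : IsOpen U) (hK : IsComponentOf K S) (hKU : K ⊆ U) :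
    ∃ V : Set X, IsOpen V ∧ IsCompact (closure V) ∧ closure V ⊆ U ∧ (S ∩ V).Nonempty ∧
      Disjoint (frontier V) S := by
  obtain ⟨x, hx, rfl⟩ := hK
  rw [connectedComponentIn_eq_image hx, Set.image_subset_iff] at hKU
  have : CompactSpace S := isCompact_iff_compactSpace.1 hS
  -- In a compact Hausdorff space a component is the intersection of the clopen sets around it; by
  -- compactness one of them already lies in `U`.
  obtain ⟨F, hFU⟩ : ∃ F : { s : Set S // IsClopen s ∧ ⟨x, hx⟩ ∈ s },
      (F : Set S) ⊆ (↑) ⁻¹' U := by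
    have : Nonempty { s : Set S // IsClopen s ∧ ⟨x, hx⟩ ∈ s } :=
      ⟨⟨Set.univ, isClopen_univ, trivial⟩⟩
    refine exists_subset_nhds_of_isCompact
      (V := fun F : { s : Set S // IsClopen s ∧ ⟨x, hx⟩ ∈ s } => (F : Set S)) ?_
      (fun F => F.2.1.isClosed.isCompact) ?_
    · intro F G
      exact ⟨⟨F ∩ G, F.2.1.inter G.2.1, F.2.2, G.2.2⟩, Set.inter_subset_left,
        Set.inter_subset_right⟩
    · rw [← connectedComponent_eq_iInter_isClopen]
      exact fun y hy => (hU.preimage continuous_subtype_val).mem_nhds (hKU hy)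
  obtain ⟨F, hF, hxF⟩ := F
  have hF₁ : IsCompact ((↑) '' F : Set X) := hF.isClosed.isCompact.image continuous_subtype_val
  have hF₂ : IsCompact ((↑) '' Fᶜ : Set X) :=
    hF.compl.isClosed.isCompact.image continuous_subtype_val
  -- `L` contains `F` in its interior and misses the rest of `S`, so no point of `S` is on the
  -- frontier of that interior.
  obtain ⟨L, hL, hFL, hLW⟩ := exists_compact_between hF₁ (hU.inter hF₂.isClosed.isOpen_compl) (by
    rintro _ ⟨y, hy, rfl⟩
    refine ⟨hFU hy, ?_⟩
    rintro ⟨w, hw, hwy⟩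
    exact hw (Subtype.ext hwy ▸ hy))
  have hcl : closure (interior L) ⊆ L := closure_minimal interior_subset hL.isClosed
  refine ⟨interior L, isOpen_interior, hL.of_isClosed_subset isClosed_closure hcl,
    fun y hy => (hLW (hcl hy)).1, ⟨x, hx, hFL ⟨⟨x, hx⟩, hxF, rfl⟩⟩, ?_⟩
  rw [Set.disjoint_left]
  intro y hy hyS
  rw [isOpen_interior.frontier_eq] at hy
  by_cases h : (⟨y, hyS⟩ : S) ∈ F
  · exact hy.2 (hFL ⟨⟨y, hyS⟩, h, rfl⟩)
  · exact (hLW (hcl hy.1)).2 ⟨⟨y, hyS⟩, h, rfl⟩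

/-- A set meeting an open set `V`, but not its frontier, has a component inside `V`. -/
theorem exists_component_subset_of_disjoint_frontier {S V : Set X} (hV : IsOpen V)
    (h : (S ∩ V).Nonempty) (hd : Disjoint (frontier V) S) :
    ∃ K, IsComponentOf K S ∧ K ⊆ V := by
  obtain ⟨x, hxS, hxV⟩ := h
  refine ⟨_, ⟨x, hxS, rfl⟩, ?_⟩
  refine isPreconnected_connectedComponentIn.subset_left_of_subset_union hV
    isClosed_closure.isOpen_compl (Set.disjoint_left.2 fun y hy hy' => hy' (subset_closure hy))
    ?_ ⟨x, mem_connectedComponentIn hxS, hxV⟩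
  intro y hy
  by_contra hyV
  rw [Set.mem_union, not_or, Set.notMem_compl_iff] at hyV
  refine Set.disjoint_left.1 hd ?_ (connectedComponentIn_subset S x hy)
  rw [hV.frontier_eq]
  exact ⟨hyV.2, hyV.1⟩

end Components

/-- With `d = u n - a`, `d * d = d * u n - d * a`. -/
theorem NuConverges.tendsto_norm_sub_mul_self {A : Type*} [NormedRing A] {u : ℕ → A} {a : A}
    (hu : NuConverges u a) :
    Tendsto (fun n => ‖(u n - a) * (u n - a)‖) atTop (𝓝 0) := by
  have h₁ := tendsto_zero_iff_norm_tendsto_zero.2 hu.2.1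
  have h₂ := tendsto_zero_iff_norm_tendsto_zero.2 hu.2.2
  simpa [mul_sub] using (h₂.sub h₁).norm

theorem mainTheorem9 {A : Type*} [NormedRing A] [NormedAlgebra ℂ A] [CompleteSpace A]
    (a : A) (u : ℕ → A) (hu : NuConverges u a)
    (U : Set ℂ) (hU : IsOpen U) (hU0 : (0 : ℂ) ∉ U)
    (hcomp : ∃ K : Set ℂ, IsComponentOf K (spectrum ℂ a) ∧ K ⊆ U) :
    ∃ n₀ : ℕ, ∀ n ≥ n₀, ∃ K : Set ℂ, IsComponentOf K (spectrum ℂ (u n)) ∧ K ⊆ U := by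
  obtain ⟨K, hK, hKU⟩ := hcomp
  obtain ⟨V, hV, hVc, hVU, ⟨w, hwa, hwV⟩, hfr⟩ :=
    exists_isOpen_frontier_disjoint_of_component (spectrum.isCompact a) hU hK hKU
  have hfrV : frontier V ⊆ closure V := frontier_subset_closure
  have hfra : frontier V ⊆ resolventSet ℂ a := fun z hz => by
    by_contra h
    exact Set.disjoint_left.1 hfr hz h
  obtain ⟨L, hL⟩ := hVc.exists_bound_of_continuousOn (f := id) continuousOn_id
  obtain ⟨r, hr, hrV⟩ : ∃ r : ℝ, 0 < r ∧ ∀ z ∈ closure V, r ≤ ‖z‖ := by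
    have h0 : (0 : ℂ) ∈ (closure V)ᶜ := fun h => hU0 (hVU h)
    obtain ⟨r, hr, hball⟩ := Metric.isOpen_iff.1 isClosed_closure.isOpen_compl 0 h0
    exact ⟨r, hr, fun z hz => not_lt.1 fun h => hball (mem_ball_zero_iff.2 h) hz⟩
  obtain ⟨C, hC⟩ := (hVc.of_isClosed_subset isClosed_frontier hfrV).exists_bound_of_continuousOn
    (differentiableOn_resolvent hfra).continuousOn
  obtain ⟨M, hM⟩ := hu.1
  set B := (L * ‖(1 : A)‖ + (M + ‖a‖)) * (2 * (r⁻¹ * (r⁻¹ * ‖(1 : A)‖)))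
  have hsmall : ∀ {f : ℕ → ℝ}, Tendsto f atTop (𝓝 0) → ∀ c : ℝ,
      ∀ᶠ n in atTop, f n * c ≤ 1 / 2 := fun hf c => by
    have := hf.mul_const c
    rw [zero_mul] at this
    exact this.eventually_le_const (by norm_num)
  refine eventually_atTop.1 ?_
  -- The three conditions serve, in order, to invert `z - d`, to bound the resolvent of `u n` on the
  -- frontier, and to return from `u n` to `a` at `w`.
  filter_upwards [hsmall hu.tendsto_norm_sub_mul_self (r⁻¹ * (r⁻¹ * ‖(1 : A)‖)),
    hsmall hu.2.1 (C * B), hsmall hu.2.1 (r⁻¹ * (L * (2 * (C * B))))] with n h₁ h₂ h₃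
  have hd : ∀ z ∈ closure V, IsUnit (algebraMap ℂ A z - (u n - a)) ∧
      ‖Ring.inverse (algebraMap ℂ A z - (u n - a))‖ ≤ B := fun z hz =>
    isUnit_algebraMap_sub_of_norm_mul_self hr (hrV z hz) (hL z hz)
      ((norm_sub_le _ _).trans (add_le_add_left (hM n) _)) h₁
  have hres : ∀ z ∈ frontier V, z ∈ resolventSet ℂ (u n) ∧
      ‖resolvent (u n) z‖ ≤ L * (2 * (C * B)) := fun z hz =>
    mem_resolventSet_and_norm_resolvent_le (norm_pos_iff.1 (hr.trans_le (hrV z (hfrV hz))))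
      (hL z (hfrV hz)) (hd z (hfrV hz)).1 (hd z (hfrV hz)).2 (hfra hz) (hC z hz) h₂
  have hmeet : (spectrum ℂ (u n) ∩ V).Nonempty := by
    by_contra hne
    have hcl : closure V ⊆ resolventSet ℂ (u n) := fun z hz => by
      rw [closure_eq_self_union_frontier] at hz
      rcases hz with hz | hz
      · by_contra h
        exact hne ⟨z, h, hz⟩
      · exact (hres z hz).1
    have hw := subset_closure hwV
    exact hwa (mem_resolventSet_of_norm_resolvent_le hr (hrV w hw) (hd w hw).1 (hcl hw)
      (Complex.norm_le_of_forall_mem_frontier_norm_le (hVc.isBounded.subset subset_closure)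
        (differentiableOn_resolvent hcl).diffContOnCl (fun z hz => (hres z hz).2) hw) h₃)
  obtain ⟨K', hK', hK'V⟩ := exists_component_subset_of_disjoint_frontier hV hmeet
    (Set.disjoint_left.2 fun z hz h => h (hres z hz).1)
  exact ⟨K', hK', hK'V.trans (subset_closure.trans hVU)⟩
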